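/- Let $N\ge 1$, let $2<p_1\le p_2\le\cdots\le p_N$ be real numbers, and put $q=\frac1N\sum_{i=1}^N p_i$. Let $g\in L^1_{loc}(\mathbb{R}^N)$ satisfy $g\ge c$ a.e. for some constant $c>0$. Let $W^{1,p_i}_{loc}(\mathbb{R}^N)$ be the set of $u\in W^{1,1}_{loc}(\mathbb{R}^N)$ whose weak partial derivatives satisfy $u_i=\frac{\partial u}{\partial x_i}\in L^{p_i}_{loc}(\mathbb{R}^N)$ for $i=1,\dots,N$. For $\delta,\gamma>0$ let $f(t)=-(t^{-\delta}+t^{-\gamma})$, $t>0$, and consider $$-\sum_{i=1}^{N}\frac{\partial}{\partial x_i}\left(\left|\frac{\partial u}{\partial x_i}\right|^{p_i-2}\frac{\partial u}{\partial x_i}\right)=g(x)f(u)\ \text{ in }\mathbb{R}^N,\qquad u>0\ \text{ in }\mathbb{R}^N.\qquad(*)$$ A function $u\in W^{1,p_i}_{loc}(\mathbb{R}^N)$ is a stable solution of $(*)$ if $u>0$ a.e., $f(u),f'(u)\in L^1_{loc}(\mathbb{R}^N)$, and for all $\varphi\in C^1_c(\mathbb{R}^N)$ $$\sum_{i=1}^N\int_{\mathbb{R}^N}|u_i|^{p_i-2}u_i\,\frac{\partial\varphi}{\partial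 x_i}\,dx=\int_{\mathbb{R}^N} g f(u)\varphi\,dx\quad\text{and}\quad \int_{\mathbb{R}^N} g f'(u)\varphi^2\,dx\le\sum_{i=1}^N(p_i-1)\int_{\mathbb{R}^N}|u_i|^{p_i-2}\left|\frac{\partial\varphi}{\partial x_i}\right|^2dx.$$ Assume that $p_i(N(q-1)+4)-N^2(q-1)>0$ for all $i=1,\dots,N$, and set $$A=\left(\frac{N(q-1)(p_N-1)}{4},\infty\right),\qquad I=\bigcap_{i=1}^N\left(\frac{N^2(q-1)(p_i-1)}{p_i(N(q-1)+4)-N^2(q-1)},\infty\right).$$ Theorem. Suppose $0<\delta<\gamma$, $\delta\in A$ and $\gamma\in I\cap[1,\infty)$, and let $u\in W^{1,p_i}_{loc}(\mathbb{R}^N)$ satisfy $u\ge 1$ a.e. in $\mathbb{R}^N$. Then $u$ is not a stable solution of $(*)$. -/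

import Mathlib

open MeasureTheory Set
open scoped ContDiff

noncomputable section

namespace AnisotropicStable

/-- The classical partial derivative of `φ : ℝ^N → ℝ` in the direction of the `i`-th
coordinate. -/
def partialDeriv {N : ℕ} (i : Fin N) (φ : EuclideanSpace ℝ (Fin N) → ℝ)
    (x : EuclideanSpace ℝ (Fin N)) : ℝ :=
  fderiv ℝ φ x (EuclideanSpace.single i 1)

/-- `v` is locally in `L^r(ℝ^N)`: it belongs to `L^r(K)` for every compact `K`. -/
def MemLpLoc {N : ℕ} (v : EuclideanSpace ℝ (Fin N) → ℝ) (r : ℝ) : Prop :=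
  ∀ K : Set (EuclideanSpace ℝ (Fin N)), IsCompact K →
    MemLp v (ENNReal.ofReal r) (volume.restrict K)

/-- `v ∈ L^1_loc` is the `i`-th weak partial derivative of `u ∈ L^1_loc` on `ℝ^N`. -/
def IsWeakPartialDeriv {N : ℕ} (i : Fin N) (u v : EuclideanSpace ℝ (Fin N) → ℝ) : Prop :=
  LocallyIntegrable u volume ∧ LocallyIntegrable v volume ∧
    ∀ φ : EuclideanSpace ℝ (Fin N) → ℝ, ContDiff ℝ ∞ φ → HasCompactSupport φ →
      ∫ x, u x * partialDeriv i φ x = - ∫ x, v x * φ x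

/-- `Du = (∂u/∂x_1, …, ∂u/∂x_N)` is the weak gradient of `u ∈ W^{1,1}_loc(ℝ^N)`, and
`∂u/∂x_i ∈ L^{p_i}_loc(ℝ^N)` for each `i`. -/
def IsWeakGradient {N : ℕ} (p : Fin N → ℝ) (u : EuclideanSpace ℝ (Fin N) → ℝ)
    (Du : Fin N → EuclideanSpace ℝ (Fin N) → ℝ) : Prop :=
  ∀ i, IsWeakPartialDeriv i u (Du i) ∧ MemLpLoc (Du i) (p i)

/-- The local anisotropic Sobolev space `W^{1,p_i}_loc(ℝ^N)`: functions in `W^{1,1}_loc(ℝ^N)`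
with `∂u/∂x_i ∈ L^{p_i}_loc(ℝ^N)` for each `i`. -/
def MemW1pLoc {N : ℕ} (p : Fin N → ℝ) (u : EuclideanSpace ℝ (Fin N) → ℝ) : Prop :=
  LocallyIntegrable u volume ∧ ∃ Du, IsWeakGradient p u Du

/-- `u` is a stable solution of
`-∑ᵢ ∂ᵢ(|∂ᵢu|^{pᵢ-2} ∂ᵢu) = g(x) f(u)`, `u > 0`, in `ℝ^N`.
The weak gradient `Du` is unique up to null sets, so it does not matter which one is used. -/
def IsStableSolution {N : ℕ} (p : Fin N → ℝ) (g : EuclideanSpace ℝ (Fin N) → ℝ) (f : ℝ → ℝ)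
    (u : EuclideanSpace ℝ (Fin N) → ℝ) : Prop :=
  MemW1pLoc p u ∧
  (∀ᵐ x, 0 < u x) ∧
  LocallyIntegrable (fun x => f (u x)) volume ∧
  LocallyIntegrable (fun x => deriv f (u x)) volume ∧
  ∃ Du : Fin N → EuclideanSpace ℝ (Fin N) → ℝ, IsWeakGradient p u Du ∧
    ∀ φ : EuclideanSpace ℝ (Fin N) → ℝ, ContDiff ℝ 1 φ → HasCompactSupport φ →
      (∑ i, ∫ x, |Du i x| ^ (p i - 2) * Du i x * partialDeriv i φ x
        = ∫ x, g x * f (u x) * φ x) ∧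
      (∫ x, g x * deriv f (u x) * φ x ^ 2
        ≤ ∑ i, (p i - 1) * ∫ x, |Du i x| ^ (p i - 2) * |partialDeriv i φ x| ^ 2)

/-- The singular nonlinearity `f(t) = -(t^{-δ} + t^{-γ})`. -/
def singularF (δ γ : ℝ) (t : ℝ) : ℝ := -(t ^ (-δ) + t ^ (-γ))

/-- `q`, the arithmetic mean of the exponents `p_1, …, p_N`. -/
def meanExp {N : ℕ} (p : Fin N → ℝ) : ℝ := (∑ i, p i) / N

/-- The last exponent `p_N`. -/
def lastExp {N : ℕ} (hN : 1 ≤ N) (p : Fin N → ℝ) : ℝ := p ⟨N - 1, by omega⟩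

/-- The interval `A = (N(q-1)(p_N-1)/4, ∞)`. -/
def setA {N : ℕ} (hN : 1 ≤ N) (p : Fin N → ℝ) : Set ℝ :=
  Ioi (N * (meanExp p - 1) * (lastExp hN p - 1) / 4)

/-- The denominator `p_i(N(q-1)+4) - N²(q-1)` in the definition of `I_i`. -/
def denomI {N : ℕ} (p : Fin N → ℝ) (i : Fin N) : ℝ :=
  p i * (N * (meanExp p - 1) + 4) - (N : ℝ) ^ 2 * (meanExp p - 1)

/-- The set `I = ⋂ᵢ I_i`, with `I_i = (N²(q-1)(p_i-1) / (p_i(N(q-1)+4) - N²(q-1)), ∞)`.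
It is used only when all the denominators are positive. -/
def setI {N : ℕ} (p : Fin N → ℝ) : Set ℝ :=
  ⋂ i, Ioi ((N : ℝ) ^ 2 * (meanExp p - 1) * (p i - 1) / denomI p i)

end AnisotropicStable

end

noncomputable section
open Filter Topology ContinuousLinearMap
open scoped Convolution

namespace AnisotropicStable

/-! Suppose `u ≥ 1` is stable. Test stability with `u ^ (-α) * η ^ m` and the equation with `u ^
(-β) * η ^ (2 * m)`, where `β = 2 * α + 1`, so that both produce the same powers of `u`. Adding `μ`
times the equation to the stability inequality, with `μ < δ`, leaves at least `(δ - μ) * c * ∫ u ^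
(-(δ + β)) * η ^ (2 * m)` on the reaction side. On the gradient side stands, for each `i`, a
quadratic form in `∂ᵢu` and `u * ∂ᵢη / η` weighted by `|∂ᵢu| ^ (pᵢ - 2)`; its `(∂ᵢu)²` coefficient
is negative when `(pᵢ - 1) * α ^ 2 < μ * β`. Hence `∂ᵢu` disappears (`exists_quadratic_absorption`),
and Young's inequality (`exists_pointwise_bound`) gives `∫ u ^ (-(δ + β)) * η ^ (2 * m) ≤ ∑ Cᵢ * ∫
|∂ᵢη| ^ rᵢ`, with `rᵢ = pᵢ * (β + δ) / (δ + pᵢ - 1)`; this is `exists_energy_estimate`.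

Dilating a cutoff by `R` makes the right side a sum of multiples of `R ^ (N - rᵢ)`. The conditions
on `δ` and on the denominators force `rᵢ > N` (`dim_lt_decayExp`), so `R → ∞` makes the integral of
the positive function `u ^ (-(δ + β))` over the unit ball nonpositive, a contradiction.

Powers of `u` times a cutoff need not be `C¹`. They are approximated by powers of the mollified `u`,
which stays at least `1`; Jensen's inequality supplies dominating functions whose integrals
converge. -/

/-! ### Dominated convergence -/

/-- Dominated convergence with a convergent sequence of dominating functions. -/
theorem tendsto_integral_of_dominated_convergence_varying {X : Type*} [MeasurableSpace X]
    {μ : Measure X} {F : ℕ → X → ℝ} {f : X → ℝ} {G : ℕ → X → ℝ} {g : X → ℝ}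
    (hF : ∀ n, AEStronglyMeasurable (F n) μ) (hG : ∀ n, Integrable (G n) μ) (hg : Integrable g μ)
    (hFG : ∀ n, ∀ᵐ x ∂μ, |F n x| ≤ G n x)
    (hFf : ∀ᵐ x ∂μ, Tendsto (fun n => F n x) atTop (𝓝 (f x)))
    (hGg : ∀ᵐ x ∂μ, Tendsto (fun n => G n x) atTop (𝓝 (g x)))
    (hint : Tendsto (fun n => ∫ x, G n x ∂μ) atTop (𝓝 (∫ x, g x ∂μ))) :
    Integrable f μ ∧ Tendsto (fun n => ∫ x, F n x ∂μ) atTop (𝓝 (∫ x, f x ∂μ)) := by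
  have hFG' := ae_all_iff.2 hFG
  have hfi : Integrable f μ := by
    refine hg.mono' (aestronglyMeasurable_of_tendsto_ae atTop hF hFf) ?_
    filter_upwards [hFf, hGg, hFG'] with x h1 h2 h3
    exact le_of_tendsto_of_tendsto' h1.abs h2 h3
  refine ⟨hfi, ?_⟩
  have hFi : ∀ n, Integrable (F n) μ := fun n => (hG n).mono' (hF n) (hFG n)
  -- truncation of `F n` to `[-g, g]`
  have hT : Tendsto (fun n => ∫ x, max (min (F n x) (g x)) (-(g x)) ∂μ) atTop
      (𝓝 (∫ x, f x ∂μ)) := by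
    refine tendsto_integral_of_dominated_convergence (fun x => |g x|) (fun n => ?_) hg.abs
      (fun n => Eventually.of_forall fun x => ?_) ?_
    · exact ((hF n).inf hg.aestronglyMeasurable).sup hg.aestronglyMeasurable.neg
    · rw [Real.norm_eq_abs, abs_le]
      have := neg_abs_le (g x)
      have := le_abs_self (g x)
      exact ⟨le_max_of_le_right (by linarith), max_le (min_le_of_right_le (by linarith))
        (by linarith)⟩
    · filter_upwards [hFf, hGg, hFG'] with x h1 h2 h3
      have h4 : |f x| ≤ g x := le_of_tendsto_of_tendsto' h1.abs h2 h3
      have h5 : max (min (f x) (g x)) (-(g x)) = f x := by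
        rw [min_eq_left (abs_le.1 h4).2, max_eq_left (abs_le.1 h4).1]
      simpa only [h5] using (h1.min (tendsto_const_nhds (x := g x))).max
        (tendsto_const_nhds (x := -(g x)))
  -- Since `G n ≥ 0`, this positive part is dominated by `|g|`. Convergence of the integrals of `G
  -- n` then transfers the limit to the opposite positive part, which bounds the truncation error.
  have hP : Tendsto (fun n => ∫ x, max (g x - G n x) 0 ∂μ) atTop (𝓝 0) := by
    have : Tendsto (fun n => ∫ x, max (g x - G n x) 0 ∂μ) atTop (𝓝 (∫ _, (0 : ℝ) ∂μ)) := by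
      refine tendsto_integral_of_dominated_convergence (fun x => |g x|)
        (fun n => ((hg.sub (hG n)).pos_part).aestronglyMeasurable) hg.abs (fun n => ?_) ?_
      · filter_upwards [hFG n] with x hx
        rw [Real.norm_eq_abs, abs_of_nonneg (le_max_right _ _)]
        have := abs_nonneg (F n x)
        exact max_le (by linarith [le_abs_self (g x)]) (abs_nonneg _)
      · filter_upwards [hGg] with x hx
        simpa using ((tendsto_const_nhds (x := g x)).sub hx).max
          (tendsto_const_nhds (x := (0 : ℝ)))
    simpa using this
  have hQ : Tendsto (fun n => ∫ x, max (G n x - g x) 0 ∂μ) atTop (𝓝 0) := by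
    have h1 : ∀ n, ∫ x, max (G n x - g x) 0 ∂μ
        = (∫ x, max (g x - G n x) 0 ∂μ) + (∫ x, G n x ∂μ) - ∫ x, g x ∂μ := by
      intro n
      have hp : Integrable (fun x => max (g x - G n x) 0) μ := (hg.sub (hG n)).pos_part
      have hpG : Integrable (fun x => max (g x - G n x) 0 + G n x) μ := hp.add (hG n)
      rw [← integral_add hp (hG n), ← integral_sub hpG hg]
      refine integral_congr_ae (Eventually.of_forall fun x => ?_)
      beta_reduce
      rcases le_total (g x) (G n x) with h | h
      · rw [max_eq_left (by linarith), max_eq_right (by linarith)]; ring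
      · rw [max_eq_right (by linarith), max_eq_left (by linarith)]; ring
    simp only [h1]
    simpa using (hP.add hint).sub_const (∫ x, g x ∂μ)
  have hD : Tendsto (fun n => ∫ x, F n x - max (min (F n x) (g x)) (-(g x)) ∂μ) atTop (𝓝 0) := by
    refine squeeze_zero_norm' ?_ hQ
    refine Eventually.of_forall fun n => ?_
    refine norm_integral_le_of_norm_le ((hG n).sub hg).pos_part ?_
    have hg0 : ∀ᵐ x ∂μ, 0 ≤ g x := by
      filter_upwards [hGg, hFG'] with x h2 h3
      exact ge_of_tendsto' h2 fun n => (abs_nonneg _).trans (h3 n)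
    filter_upwards [hFG n, hg0] with x hx hx0
    rw [Real.norm_eq_abs]
    have h1 := abs_le.1 hx
    rcases le_total (F n x) (g x) with h | h
    · rw [min_eq_left h]
      rcases le_total (-(g x)) (F n x) with h' | h'
      · rw [max_eq_left h']; simp
      · rw [max_eq_right h', abs_of_nonpos (by linarith)]
        exact le_max_of_le_left (by linarith)
    · rw [min_eq_right h, max_eq_left (by linarith), abs_of_nonneg (by linarith)]
      exact le_max_of_le_left (by linarith)
  have := hD.add hT
  rw [zero_add] at this
  refine this.congr fun n => ?_
  have hTi : Integrable (fun x => max (min (F n x) (g x)) (-(g x))) μ := ((hFi n).inf hg).sup hg.neg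
  rw [integral_sub (hFi n) hTi]; ring

/-! ### Mollification of locally integrable functions -/

variable {N : ℕ}

local notation "𝔼" => EuclideanSpace ℝ (Fin N)

/-- The mollification of `v` by a smooth bump function. -/
def mollify (φ : ContDiffBump (0 : 𝔼)) (v : 𝔼 → ℝ) : 𝔼 → ℝ :=
  φ.normed volume ⋆[lsmul ℝ ℝ, volume] v

theorem mollify_apply (φ : ContDiffBump (0 : 𝔼)) (v : 𝔼 → ℝ) (x : 𝔼) :
    mollify φ v x = ∫ t, φ.normed volume (x - t) * v t := by
  simp [mollify, convolution_lsmul_swap]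

theorem integrable_mollify_integrand (φ : ContDiffBump (0 : 𝔼)) {v : 𝔼 → ℝ}
    (hv : LocallyIntegrable v volume) (x : 𝔼) :
    Integrable (fun t => φ.normed volume (x - t) * v t) := by
  have := (φ.hasCompactSupport_normed (μ := volume)).convolutionExists_left (lsmul ℝ ℝ)
    φ.continuous_normed hv x
  simpa using this.integrable_swap

theorem integral_bump_sub (φ : ContDiffBump (0 : 𝔼)) (x : 𝔼) :
    ∫ t, φ.normed volume (x - t) = 1 := by
  rw [integral_sub_left_eq_self (fun t => φ.normed volume t) volume x, φ.integral_normed]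

theorem integrable_bump_sub (φ : ContDiffBump (0 : 𝔼)) (x : 𝔼) :
    Integrable (fun t => φ.normed volume (x - t)) :=
  (φ.integrable_normed (μ := volume)).comp_sub_left x

theorem mollify_contDiff (φ : ContDiffBump (0 : 𝔼)) {v : 𝔼 → ℝ}
    (hv : LocallyIntegrable v volume) : ContDiff ℝ 1 (mollify φ v) :=
  (φ.hasCompactSupport_normed (μ := volume)).contDiff_convolution_left (n := 1) (lsmul ℝ ℝ)
    φ.contDiff_normed hv

theorem one_le_mollify (φ : ContDiffBump (0 : 𝔼)) {v : 𝔼 → ℝ}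
    (hv : LocallyIntegrable v volume) (h1 : ∀ᵐ x, 1 ≤ v x) (x : 𝔼) : 1 ≤ mollify φ v x := by
  rw [mollify_apply, ← integral_bump_sub φ x]
  refine integral_mono_ae (integrable_bump_sub φ x) (integrable_mollify_integrand φ hv x) ?_
  filter_upwards [h1] with t ht
  exact le_mul_of_one_le_right (φ.nonneg_normed _) ht

/-- The derivative falls on the kernel, and the reflected kernel `t ↦ φ.normed volume (x - t)` is an
admissible test function for the weak derivative; reflection and integration by parts each
contribute a sign. -/
theorem partialDeriv_mollify (φ : ContDiffBump (0 : 𝔼)) {u v : 𝔼 → ℝ} {i : Fin N}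
    (h : IsWeakPartialDeriv i u v) (x : 𝔼) :
    partialDeriv i (mollify φ u) x = mollify φ v x := by
  have hc := φ.hasCompactSupport_normed (μ := volume)
  have h1 := hc.hasFDerivAt_convolution_left (lsmul ℝ ℝ) (φ.contDiff_normed (n := 1)) h.1 x
  rw [partialDeriv, mollify, h1.fderiv, mollify_apply]
  have h2 : ContDiff ℝ ∞ (fun t => φ.normed volume (x - t)) :=
    φ.contDiff_normed.comp (contDiff_const.sub contDiff_id)
  have h3 : HasCompactSupport (fun t => φ.normed volume (x - t)) :=
    hc.comp_homeomorph (Homeomorph.subLeft x)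
  have h4 := h.2.2 _ h2 h3
  have h5 : ∀ t, partialDeriv i (fun t => φ.normed volume (x - t)) t
      = - (fderiv ℝ (φ.normed volume) (x - t) (EuclideanSpace.single i 1)) := by
    intro t
    have h := ((φ.contDiff_normed (μ := volume) (n := 1)).differentiable (by norm_num)
      (x - t)).hasFDerivAt.comp t ((hasFDerivAt_id t).const_sub x)
    change fderiv ℝ (φ.normed volume ∘ HSub.hSub x) t _ = _
    rw [h.fderiv]
    simp
  simp only [h5, mul_neg, integral_neg, neg_inj] at h4
  have h6 : Integrable
      (fun t => ((lsmul ℝ ℝ).precompL 𝔼 (fderiv ℝ (φ.normed volume) (x - t))) (u t)) := by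
    have := (hc.fderiv ℝ).convolutionExists_left ((lsmul ℝ ℝ).precompL 𝔼)
      ((φ.contDiff_normed (n := 1)).continuous_fderiv (by norm_num)) h.1 x
    exact this.integrable_swap
  rw [convolution_eq_swap, ContinuousLinearMap.integral_apply h6]
  simp only [precompL_apply, lsmul_apply, smul_eq_mul]
  simpa [mul_comm] using h4

/-- Jensen's inequality for the probability density `φ.normed volume (x - ·)`. It controls powers of
mollified gradients by a sequence whose weighted integrals converge. -/
theorem abs_mollify_rpow_le (φ : ContDiffBump (0 : 𝔼)) {v : 𝔼 → ℝ} {p : ℝ} (hp : 1 ≤ p)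
    (hv : LocallyIntegrable v volume) (hvp : LocallyIntegrable (fun x => |v x| ^ p) volume)
    (x : 𝔼) : |mollify φ v x| ^ p ≤ mollify φ (fun y => |v y| ^ p) x := by
  have hva : LocallyIntegrable (fun y => |v y|) volume := fun y => (hv y).norm
  have h0 : |mollify φ v x| ≤ mollify φ (fun y => |v y|) x := by
    rw [mollify_apply, mollify_apply]
    refine (abs_integral_le_integral_abs).trans (le_of_eq ?_)
    congr 1; ext t
    rw [abs_mul, abs_of_nonneg (φ.nonneg_normed _)]
  refine (Real.rpow_le_rpow (abs_nonneg _) h0 (by linarith)).trans ?_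
  set b := mollify φ (fun y => |v y|) x with hb
  have hb0 : 0 ≤ b := (abs_nonneg _).trans h0
  -- integrate the tangent line inequality at `b` against the bump function
  have htan : ∀ y : ℝ, 0 ≤ y → b ^ p + p * b ^ (p - 1) * (y - b) ≤ y ^ p := by
    intro y hy
    rcases hb0.eq_or_lt with h | h
    · rw [← h, Real.zero_rpow (by linarith)]
      rcases hp.eq_or_lt with h' | h'
      · subst h'; simp
      · rw [Real.zero_rpow (by linarith)]; simpa using Real.rpow_nonneg hy p
    · have h1 := one_add_mul_self_le_rpow_one_add (s := y / b - 1)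
        (by have : 0 ≤ y / b := by positivity
            linarith) hp
      rw [add_sub_cancel, Real.div_rpow hy hb0, le_div_iff₀ (by positivity)] at h1
      refine le_trans (le_of_eq ?_) h1
      rw [Real.rpow_sub_one h.ne']
      field_simp
  have hI1 := integrable_mollify_integrand φ hva x
  have hI2 := integrable_bump_sub φ x
  have e1 : ∫ t, (b ^ p - p * b ^ (p - 1) * b) * φ.normed volume (x - t)
      + p * b ^ (p - 1) * (φ.normed volume (x - t) * |v t|) = b ^ p := by
    rw [integral_add (hI2.const_mul _) (hI1.const_mul _), integral_const_mul, integral_const_mul,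
      integral_bump_sub, ← mollify_apply φ (fun y => |v y|), ← hb]
    ring
  rw [mollify_apply, ← e1]
  refine integral_mono ((hI2.const_mul _).add (hI1.const_mul _))
    (integrable_mollify_integrand φ hvp x) fun t => ?_
  have h1 := mul_le_mul_of_nonneg_left (htan |v t| (abs_nonneg _))
    (φ.nonneg_normed (μ := volume) (x - t))
  beta_reduce
  linarith

/-- Fubini and evenness of the kernel. Only values of `G` within `φ.rOut` of the support of `Ψ`
matter, so `G` may be cut off to the ball `L` to become integrable. -/
theorem integral_mul_mollify (φ : ContDiffBump (0 : 𝔼)) {Ψ G : 𝔼 → ℝ} (hΨ : Continuous Ψ)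
    (hΨc : HasCompactSupport Ψ) (hG : LocallyIntegrable G volume) :
    ∫ x, Ψ x * mollify φ G x = ∫ y, mollify φ Ψ y * G y := by
  obtain ⟨R, hR⟩ := hΨc.isCompact.isBounded.subset_closedBall (0 : 𝔼)
  set L := Metric.closedBall (0 : 𝔼) (R + φ.rOut)
  have hGL : Integrable (L.indicator G) :=
    (hG.integrableOn_isCompact (isCompact_closedBall _ _)).integrable_indicator
      measurableSet_closedBall
  obtain ⟨C, hC⟩ := φ.continuous_normed (μ := volume).bounded_above_of_compact_support
    φ.hasCompactSupport_normed
  have hint : Integrable (fun z : 𝔼 × 𝔼 => φ.normed volume (z.1 - z.2) *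
      (Ψ z.1 * L.indicator G z.2)) (volume.prod volume) := by
    refine ((hΨ.integrable_of_hasCompactSupport hΨc).mul_prod hGL).bdd_mul (c := C) ?_
      (Eventually.of_forall fun z => hC _)
    exact (φ.continuous_normed.comp (continuous_fst.sub continuous_snd)).aestronglyMeasurable
  have key : ∀ x y, φ.normed volume (x - y) * (Ψ x * L.indicator G y)
      = Ψ x * (φ.normed volume (x - y) * G y) := by
    intro x y
    by_cases hx : x ∈ tsupport Ψ
    · by_cases hy : y ∈ L
      · rw [indicator_of_mem hy]; ring
      · have : φ.normed volume (x - y) = 0 := by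
          rw [← Function.notMem_support, φ.support_normed_eq]
          intro h
          apply hy
          have h1 := hR hx
          simp only [L, Metric.mem_closedBall, Metric.mem_ball, dist_zero_right] at h h1 ⊢
          have := norm_sub_le x (x - y)
          rw [sub_sub_cancel] at this
          linarith
        simp [this]
    · simp [image_eq_zero_of_notMem_tsupport hx]
  have := integral_integral_swap (f := fun x y => φ.normed volume (x - y) *
      (Ψ x * L.indicator G y)) hint
  simp only [key] at this
  simp only [mollify_apply, ← integral_const_mul, this]
  refine integral_congr_ae (Eventually.of_forall fun y => ?_)
  beta_reduce
  rw [← integral_mul_const]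
  refine integral_congr_ae (Eventually.of_forall fun x => ?_)
  beta_reduce
  rw [← neg_sub x y, φ.normed_neg]; ring

/-- A sequence of bump functions concentrating at the origin. -/
def bump (N : ℕ) (n : ℕ) : ContDiffBump (0 : EuclideanSpace ℝ (Fin N)) where
  rIn := 1 / (n + 1)
  rOut := 2 / (n + 1)
  rIn_pos := by positivity
  rIn_lt_rOut := by gcongr; norm_num

theorem tendsto_bump_rOut : Tendsto (fun n => (bump N n).rOut) atTop (𝓝 0) := by
  have := (tendsto_one_div_add_atTop_nhds_zero_nat (𝕜 := ℝ)).const_mul 2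
  simpa [bump, div_eq_mul_inv] using this

theorem ae_tendsto_mollify {v : 𝔼 → ℝ} (hv : LocallyIntegrable v volume) :
    ∀ᵐ x, Tendsto (fun n => mollify (bump N n) v x) atTop (𝓝 (v x)) :=
  -- The bounded ratio `rOut / rIn = 2` gives convergence at almost every point.
  ContDiffBump.ae_convolution_tendsto_right_of_locallyIntegrable (K := 2) tendsto_bump_rOut
    (Eventually.of_forall fun n => by simp [bump, div_eq_mul_inv]) hv

theorem tendsto_integral_mul_mollify {Ψ G : 𝔼 → ℝ} (hΨ : Continuous Ψ)
    (hΨc : HasCompactSupport Ψ) (hG : LocallyIntegrable G volume) :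
    Tendsto (fun n => ∫ x, Ψ x * mollify (bump N n) G x) atTop (𝓝 (∫ x, Ψ x * G x)) := by
  -- With the mollifier moved onto `Ψ`, convergence holds at every point, with a uniform bound `C`
  -- and supports inside one ball, since `rOut ≤ 2`.
  simp only [integral_mul_mollify _ hΨ hΨc hG]
  obtain ⟨R, hR⟩ := hΨc.isCompact.isBounded.subset_closedBall (0 : 𝔼)
  set L := Metric.closedBall (0 : 𝔼) (R + 2)
  obtain ⟨C, hC⟩ := hΨ.bounded_above_of_compact_support hΨc
  have hΨl : LocallyIntegrable Ψ volume := hΨ.locallyIntegrable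
  have hGL : Integrable (L.indicator G) :=
    (hG.integrableOn_isCompact (isCompact_closedBall _ _)).integrable_indicator
      measurableSet_closedBall
  refine tendsto_integral_of_dominated_convergence (fun x => C * |L.indicator G x|)
    (fun n => ?_) (hGL.abs.const_mul C) (fun n => Eventually.of_forall fun x => ?_)
    (Eventually.of_forall fun x => ?_)
  · exact (mollify_contDiff _ hΨl).continuous.aestronglyMeasurable.mul hG.aestronglyMeasurable
  · by_cases hx : x ∈ L
    · rw [indicator_of_mem hx, norm_mul, Real.norm_eq_abs (G x)]
      gcongr
      rw [mollify_apply]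
      calc _ ≤ ∫ t, C * (bump N n).normed volume (x - t) := by
            refine norm_integral_le_of_norm_le ((integrable_bump_sub _ x).const_mul C)
              (Eventually.of_forall fun t => ?_)
            rw [norm_mul, Real.norm_of_nonneg ((bump N n).nonneg_normed _), mul_comm]
            exact mul_le_mul_of_nonneg_right (hC t) ((bump N n).nonneg_normed _)
        _ = C := by rw [integral_const_mul, integral_bump_sub, mul_one]
    · have : mollify (bump N n) Ψ x = 0 := by
        rw [mollify_apply]
        refine integral_eq_zero_of_ae (Eventually.of_forall fun t => ?_)
        by_cases ht : t ∈ tsupport Ψ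
        · have : (bump N n).normed volume (x - t) = 0 := by
            rw [← Function.notMem_support, ContDiffBump.support_normed_eq]
            intro h
            apply hx
            have h1 := hR ht
            have h2 : (bump N n).rOut ≤ 2 := div_le_self (by norm_num) (by simp)
            simp only [L, Metric.mem_closedBall, Metric.mem_ball, dist_zero_right] at h h1 ⊢
            have := norm_add_le t (x - t)
            rw [add_sub_cancel] at this
            linarith
          simp [this]
        · simp [image_eq_zero_of_notMem_tsupport ht]
      simp [this, indicator_of_notMem hx]
  · have h := ContDiffBump.convolution_tendsto_right_of_continuous (μ := volume)
      (tendsto_bump_rOut (N := N)) hΨ x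
    exact h.mul_const (G x)

/-! ### Negative powers of `u` as test functions -/

theorem partialDeriv_rpow_mul {w Ψ : 𝔼 → ℝ} {x : 𝔼} (hw : DifferentiableAt ℝ w x)
    (hΨ : DifferentiableAt ℝ Ψ x) (hx : 0 < w x) (κ : ℝ) (i : Fin N) :
    partialDeriv i (fun y => w y ^ (-κ) * Ψ y) x
      = -κ * w x ^ (-κ - 1) * partialDeriv i w x * Ψ x + w x ^ (-κ) * partialDeriv i Ψ x := by
  have h := (hw.hasFDerivAt.rpow_const (p := -κ) (Or.inl hx.ne')).mul hΨ.hasFDerivAt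
  change fderiv ℝ ((fun y => w y ^ (-κ)) * Ψ) x _ = _
  rw [h.fderiv]
  simp [partialDeriv]
  ring

theorem MemLpLoc.locallyIntegrable_rpow {v : 𝔼 → ℝ} {p : ℝ} (hp : 0 < p) (hv : MemLpLoc v p) :
    LocallyIntegrable (fun x => |v x| ^ p) volume := by
  rw [locallyIntegrable_iff]
  intro K hK
  have := (hv K hK).integrable_norm_rpow (by simpa using hp) (by simp)
  simpa [IntegrableOn, ENNReal.toReal_ofReal hp.le] using this

theorem partialDeriv_eq_zero_of_notMem_tsupport {Ψ : 𝔼 → ℝ} {x : 𝔼} (hx : x ∉ tsupport Ψ)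
    (i : Fin N) : partialDeriv i Ψ x = 0 := by
  rw [partialDeriv, fderiv_of_notMem_tsupport ℝ hx, zero_apply]

theorem continuous_partialDeriv {Ψ : 𝔼 → ℝ} (hΨ : ContDiff ℝ 1 Ψ) (i : Fin N) :
    Continuous (partialDeriv i Ψ) :=
  (hΨ.continuous_fderiv (by norm_num)).clm_apply continuous_const

theorem hasCompactSupport_partialDeriv {Ψ : 𝔼 → ℝ} (hΨ : HasCompactSupport Ψ) (i : Fin N) :
    HasCompactSupport (partialDeriv i Ψ) :=
  hΨ.mono' fun x hx => by
    by_contra h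
    exact hx (partialDeriv_eq_zero_of_notMem_tsupport h i)

theorem add_rpow_le_two_rpow_mul {p a b : ℝ} (hp : 1 ≤ p) (ha : 0 ≤ a) (hb : 0 ≤ b) :
    (a + b) ^ p ≤ 2 ^ (p - 1) * (a ^ p + b ^ p) := by
  lift a to NNReal using ha
  lift b to NNReal using hb
  exact_mod_cast NNReal.rpow_add_le_mul_rpow_add_rpow a b hp

theorem rpow_neg_le_one {t κ : ℝ} (ht : 1 ≤ t) (hκ : 0 ≤ κ) : t ^ (-κ) ≤ 1 :=
  Real.rpow_le_one_of_one_le_of_nonpos ht (by linarith)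

/-- Passage to the limit in expressions that involve the partial derivatives of the test
functions `(ρₙ ⋆ u) ^ (-κ) * Ψ`. -/
theorem tendsto_integral_comp_partialDeriv {p κ : ℝ} (hp : 2 < p) (hκ : 0 ≤ κ) {u v Ψ : 𝔼 → ℝ}
    {i : Fin N} (h : IsWeakPartialDeriv i u v) (hv : MemLpLoc v p) (hu1 : ∀ᵐ x, 1 ≤ u x)
    (hΨ : ContDiff ℝ 1 Ψ) (hΨc : HasCompactSupport Ψ) {F : ℝ → ℝ → ℝ}
    (hF : Continuous (Function.uncurry F)) (hF0 : ∀ a, F a 0 = 0)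
    (hFb : ∀ a b, |F a b| ≤ |a| ^ p + |b| ^ p) :
    Integrable (fun x => F (v x)
        (-κ * u x ^ (-κ - 1) * v x * Ψ x + u x ^ (-κ) * partialDeriv i Ψ x)) ∧
    Tendsto (fun n => ∫ x, F (v x)
        (partialDeriv i (fun y => mollify (bump N n) u y ^ (-κ) * Ψ y) x)) atTop
      (𝓝 (∫ x, F (v x)
        (-κ * u x ^ (-κ - 1) * v x * Ψ x + u x ^ (-κ) * partialDeriv i Ψ x))) := by
  have hvp := hv.locallyIntegrable_rpow (by linarith)
  have hp0 : 0 < p := by linarith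
  have hw1 : ∀ n x, 1 ≤ mollify (bump N n) u x := fun n x => one_le_mollify _ h.1 hu1 x
  have hd : ∀ n x, partialDeriv i (fun y => mollify (bump N n) u y ^ (-κ) * Ψ y) x
      = -κ * mollify (bump N n) u x ^ (-κ - 1) * mollify (bump N n) v x * Ψ x
        + mollify (bump N n) u x ^ (-κ) * partialDeriv i Ψ x := by
    intro n x
    rw [partialDeriv_rpow_mul ((mollify_contDiff _ h.1).differentiable (by norm_num) x)
      (hΨ.differentiable (by norm_num) x) (by linarith [hw1 n x]), partialDeriv_mollify _ h]
  simp only [hd]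
  have hΨp : Continuous fun x => 2 ^ (p - 1) * (κ ^ p * |Ψ x| ^ p) :=
    continuous_const.mul (continuous_const.mul (hΨ.continuous.abs.rpow_const
      fun x => Or.inr hp0.le))
  have hΨpc : HasCompactSupport fun x => 2 ^ (p - 1) * (κ ^ p * |Ψ x| ^ p) := by
    refine hΨc.mono fun x hx h0 => hx ?_
    simp [h0, Real.zero_rpow hp0.ne']
  have hDp : Continuous fun x => 2 ^ (p - 1) * |partialDeriv i Ψ x| ^ p :=
    continuous_const.mul ((continuous_partialDeriv hΨ i).abs.rpow_const fun x => Or.inr hp0.le)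
  have hDpc : HasCompactSupport fun x => 2 ^ (p - 1) * |partialDeriv i Ψ x| ^ p := by
    refine (hasCompactSupport_partialDeriv hΨc i).mono fun x hx h0 => hx ?_
    simp [h0, Real.zero_rpow hp0.ne']
  have hK : Integrable ((tsupport Ψ).indicator fun x => |v x| ^ p) :=
    (hvp.integrableOn_isCompact hΨc.isCompact).integrable_indicator
      (isClosed_tsupport Ψ).measurableSet
  have hI1 := hK.add (hDp.integrable_of_hasCompactSupport hDpc)
  have hI2 : ∀ {G : 𝔼 → ℝ}, LocallyIntegrable G volume →
      Integrable fun x => 2 ^ (p - 1) * (κ ^ p * |Ψ x| ^ p) * G x := fun hG =>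
    hG.integrable_smul_left_of_hasCompactSupport hΨp hΨpc
  -- The factor `|ρₙ ⋆ v| ^ p` has no evident fixed dominating function. It is bounded by `ρₙ ⋆ |v|
  -- ^ p`, whose integral against a continuous compactly supported weight converges.
  refine tendsto_integral_of_dominated_convergence_varying
    (G := fun n x => ((tsupport Ψ).indicator (fun x => |v x| ^ p) x
      + 2 ^ (p - 1) * |partialDeriv i Ψ x| ^ p)
      + 2 ^ (p - 1) * (κ ^ p * |Ψ x| ^ p) * mollify (bump N n) (fun y => |v y| ^ p) x)
    (g := fun x => ((tsupport Ψ).indicator (fun x => |v x| ^ p) x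
      + 2 ^ (p - 1) * |partialDeriv i Ψ x| ^ p)
      + 2 ^ (p - 1) * (κ ^ p * |Ψ x| ^ p) * |v x| ^ p)
    (fun n => ?_) (fun n => ?_) ?_ (fun n => Eventually.of_forall fun x => ?_) ?_ ?_ ?_
  · have hwc := (mollify_contDiff (bump N n) h.1).continuous
    have hvc := (mollify_contDiff (bump N n) h.2.1).continuous
    have hc : Continuous fun x => -κ * mollify (bump N n) u x ^ (-κ - 1) *
        mollify (bump N n) v x * Ψ x + mollify (bump N n) u x ^ (-κ) * partialDeriv i Ψ x := by
      have h1 : ∀ r : ℝ, Continuous fun x => mollify (bump N n) u x ^ r := fun r =>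
        hwc.rpow_const fun x => Or.inl (by linarith [hw1 n x])
      exact (((continuous_const.mul (h1 _)).mul hvc).mul hΨ.continuous).add
        ((h1 _).mul (continuous_partialDeriv hΨ i))
    exact hF.comp_aestronglyMeasurable
      (h.2.1.aestronglyMeasurable.prodMk hc.aestronglyMeasurable)
  · exact hI1.add (hI2 (mollify_contDiff (bump N n) hvp).continuous.locallyIntegrable)
  · exact hI1.add (hI2 hvp)
  · by_cases hx : x ∈ tsupport Ψ
    · rw [indicator_of_mem hx]
      refine (hFb _ _).trans ?_
      have h1 : |-κ * mollify (bump N n) u x ^ (-κ - 1) * mollify (bump N n) v x * Ψ x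
          + mollify (bump N n) u x ^ (-κ) * partialDeriv i Ψ x|
          ≤ κ * |mollify (bump N n) v x| * |Ψ x| + |partialDeriv i Ψ x| := by
        have h2 := rpow_neg_le_one (hw1 n x) (κ := κ + 1) (by linarith)
        rw [show -(κ + 1) = -κ - 1 by ring] at h2
        have h3 := rpow_neg_le_one (hw1 n x) hκ
        have hw0 : 0 < mollify (bump N n) u x := by linarith [hw1 n x]
        have h4 := Real.rpow_pos_of_pos hw0 (-κ - 1)
        have h5 := Real.rpow_pos_of_pos hw0 (-κ)
        refine (abs_add_le _ _).trans ?_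
        simp only [abs_mul, abs_neg, abs_of_pos h4, abs_of_pos h5, abs_of_nonneg hκ]
        gcongr
        · exact mul_le_of_le_one_right hκ h2
        · exact mul_le_of_le_one_left (abs_nonneg _) h3
      have h2 := Real.rpow_le_rpow (abs_nonneg _) h1 hp0.le
      have h3 := add_rpow_le_two_rpow_mul
        (show 1 ≤ p by linarith) (show 0 ≤ κ * |mollify (bump N n) v x| * |Ψ x| by positivity)
        (abs_nonneg (partialDeriv i Ψ x))
      rw [Real.mul_rpow (by positivity) (by positivity), Real.mul_rpow hκ (by positivity)] at h3
      have h4 := abs_mollify_rpow_le (bump N n) (by linarith) h.2.1 hvp x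
      have h5 : 2 ^ (p - 1) * (κ ^ p * |Ψ x| ^ p) * |mollify (bump N n) v x| ^ p
          ≤ 2 ^ (p - 1) * (κ ^ p * |Ψ x| ^ p) * mollify (bump N n) (fun y => |v y| ^ p) x := by
        gcongr
      linarith
    · simp [image_eq_zero_of_notMem_tsupport hx, partialDeriv_eq_zero_of_notMem_tsupport hx, hF0,
        indicator_of_notMem hx, Real.zero_rpow hp0.ne']
  · filter_upwards [ae_tendsto_mollify h.1, ae_tendsto_mollify h.2.1, hu1] with x h1 h2 h3
    have h4 : ∀ r : ℝ, Tendsto (fun n => mollify (bump N n) u x ^ r) atTop (𝓝 (u x ^ r)) :=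
      fun r => h1.rpow_const (Or.inl (by linarith))
    have h5 := (((tendsto_const_nhds (x := -κ)).mul (h4 (-κ - 1))).mul h2).mul_const (Ψ x)
    have h6 := h5.add ((h4 (-κ)).mul_const (partialDeriv i Ψ x))
    exact (hF.tendsto _).comp ((tendsto_const_nhds (x := v x)).prodMk_nhds h6)
  · filter_upwards [ae_tendsto_mollify hvp] with x h1
    exact (h1.const_mul _).const_add _
  · have e1 := fun n => integral_add hI1
      (hI2 (mollify_contDiff (bump N n) hvp).continuous.locallyIntegrable)
    have e2 := integral_add hI1 (hI2 hvp)
    simp only [Pi.add_apply] at e1 e2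
    simp only [e1, e2]
    exact (tendsto_integral_mul_mollify hΨp hΨpc hvp).const_add _

/-- The bound `(ρₙ ⋆ u) ^ (-κ) ≤ 1` makes `|Ψ| ^ j * |H|` a fixed dominating function. The equation
uses `j = 1`, stability `j = 2`. -/
theorem tendsto_integral_mul_test {κ : ℝ} (hκ : 0 ≤ κ) {u H Ψ : 𝔼 → ℝ}
    (hu : LocallyIntegrable u volume) (hu1 : ∀ᵐ x, 1 ≤ u x) (hH : LocallyIntegrable H volume)
    (hΨ : Continuous Ψ) (hΨc : HasCompactSupport Ψ) {j : ℕ} (hj : j ≠ 0) :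
    Integrable (fun x => H x * (u x ^ (-κ) * Ψ x) ^ j) ∧
    Tendsto (fun n => ∫ x, H x * (mollify (bump N n) u x ^ (-κ) * Ψ x) ^ j) atTop
      (𝓝 (∫ x, H x * (u x ^ (-κ) * Ψ x) ^ j)) := by
  have hw1 : ∀ n x, 1 ≤ mollify (bump N n) u x := fun n x => one_le_mollify _ hu hu1 x
  have hc : HasCompactSupport fun x => |Ψ x| ^ j := by
    refine hΨc.mono fun x hx h0 => hx ?_
    simp [h0, hj]
  have hI : Integrable fun x => |Ψ x| ^ j * |H x| :=
    LocallyIntegrable.integrable_smul_left_of_hasCompactSupport (f := fun x => |H x|)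
      (fun y => (hH y).norm) (hΨ.abs.pow j) hc
  have hb : ∀ n x, |H x * (mollify (bump N n) u x ^ (-κ) * Ψ x) ^ j| ≤ |Ψ x| ^ j * |H x| := by
    intro n x
    have h5 := Real.rpow_pos_of_pos (show 0 < mollify (bump N n) u x by linarith [hw1 n x]) (-κ)
    rw [abs_mul, abs_pow, abs_mul, mul_comm, abs_of_pos h5]
    gcongr
    exact mul_le_of_le_one_left (abs_nonneg _) (rpow_neg_le_one (hw1 n x) hκ)
  refine tendsto_integral_of_dominated_convergence_varying
    (G := fun _ x => |Ψ x| ^ j * |H x|) (g := fun x => |Ψ x| ^ j * |H x|)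
    (fun n => ?_) (fun _ => hI) hI (fun n => Eventually.of_forall (hb n)) ?_
    (Eventually.of_forall fun x => tendsto_const_nhds) tendsto_const_nhds
  · have hwc := (mollify_contDiff (bump N n) hu).continuous
    have h1 : Continuous fun x => mollify (bump N n) u x ^ (-κ) :=
      hwc.rpow_const fun x => Or.inl (by linarith [hw1 n x])
    exact hH.aestronglyMeasurable.mul ((h1.mul hΨ).pow j).aestronglyMeasurable
  · filter_upwards [ae_tendsto_mollify hu, hu1] with x h1 h3
    have h4 : Tendsto (fun n => mollify (bump N n) u x ^ (-κ)) atTop (𝓝 (u x ^ (-κ))) :=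
      h1.rpow_const (Or.inl (by linarith))
    exact ((h4.mul_const (Ψ x)).pow j).const_mul (H x)

theorem contDiff_test {κ : ℝ} (φ : ContDiffBump (0 : 𝔼)) {u Ψ : 𝔼 → ℝ}
    (hu : LocallyIntegrable u volume) (hu1 : ∀ᵐ x, 1 ≤ u x) (hΨ : ContDiff ℝ 1 Ψ) :
    ContDiff ℝ 1 fun x => mollify φ u x ^ (-κ) * Ψ x :=
  ((mollify_contDiff φ hu).rpow_const_of_ne fun x => by
    linarith [one_le_mollify φ hu hu1 x]).mul hΨ

theorem hasCompactSupport_test {κ : ℝ} (φ : ContDiffBump (0 : 𝔼)) {u Ψ : 𝔼 → ℝ}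
    (hΨc : HasCompactSupport Ψ) : HasCompactSupport fun x => mollify φ u x ^ (-κ) * Ψ x :=
  hΨc.mul_left

/-- Free `c` and `d` let one bound serve both `|a| ^ (p - 2) * a * b` and `|a| ^ (p - 2) * |b| ^ 2`.
-/
theorem abs_rpow_sub_two_mul_le {p : ℝ} (hp : 2 < p) (a b c d : ℝ) (hc : |c| ≤ max |a| |b|)
    (hd : |d| ≤ max |a| |b|) : |(|a| ^ (p - 2) * (c * d))| ≤ |a| ^ p + |b| ^ p := by
  set M := max |a| |b|
  have hM : 0 ≤ M := (abs_nonneg a).trans (le_max_left _ _)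
  calc |(|a| ^ (p - 2) * (c * d))| = |a| ^ (p - 2) * (|c| * |d|) := by
        rw [abs_mul, abs_mul, abs_of_nonneg (Real.rpow_nonneg (abs_nonneg a) _)]
    _ ≤ M ^ (p - 2) * (M * M) := by
        have := Real.rpow_le_rpow (abs_nonneg a) (le_max_left |a| |b|)
          (show 0 ≤ p - 2 by linarith)
        gcongr
    _ = M ^ p := by
        rw [← pow_two, ← Real.rpow_natCast, ← Real.rpow_add_of_nonneg hM (by linarith) (by simp)]
        norm_num
    _ ≤ _ := by
        rcases max_choice |a| |b| with h | h
        · rw [show M = |a| from h]; linarith [Real.rpow_nonneg (abs_nonneg b) p]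
        · rw [show M = |b| from h]; linarith [Real.rpow_nonneg (abs_nonneg a) p]

/-- The weak equation tested with `u ^ (-κ) * Ψ`. -/
theorem weak_equation_test {p : Fin N → ℝ} (hp : ∀ i, 2 < p i) {κ : ℝ} (hκ : 0 ≤ κ)
    {u H : 𝔼 → ℝ} {Du : Fin N → 𝔼 → ℝ} (hDu : IsWeakGradient p u Du)
    (hu : LocallyIntegrable u volume) (hu1 : ∀ᵐ x, 1 ≤ u x) (hH : LocallyIntegrable H volume)
    (heq : ∀ φ : 𝔼 → ℝ, ContDiff ℝ 1 φ → HasCompactSupport φ →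
      ∑ i, ∫ x, |Du i x| ^ (p i - 2) * Du i x * partialDeriv i φ x = ∫ x, H x * φ x)
    {Ψ : 𝔼 → ℝ} (hΨ : ContDiff ℝ 1 Ψ) (hΨc : HasCompactSupport Ψ) :
    Integrable (fun x => H x * (u x ^ (-κ) * Ψ x)) ∧
    (∀ i, Integrable fun x => |Du i x| ^ (p i - 2) * Du i x *
      (-κ * u x ^ (-κ - 1) * Du i x * Ψ x + u x ^ (-κ) * partialDeriv i Ψ x)) ∧
    ∑ i, ∫ x, |Du i x| ^ (p i - 2) * Du i x *
      (-κ * u x ^ (-κ - 1) * Du i x * Ψ x + u x ^ (-κ) * partialDeriv i Ψ x)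
      = ∫ x, H x * (u x ^ (-κ) * Ψ x) := by
  have h1 := tendsto_integral_mul_test hκ hu hu1 hH hΨ.continuous hΨc one_ne_zero
  simp only [pow_one] at h1
  have h2 := fun i => tendsto_integral_comp_partialDeriv (hp i) hκ (hDu i).1 (hDu i).2 hu1 hΨ hΨc
    (F := fun a b => |a| ^ (p i - 2) * a * b)
    ((((continuous_fst.abs.rpow_const fun _ => Or.inr (by linarith [hp i])).mul
      continuous_fst).mul continuous_snd)) (fun a => by simp) (fun a b => by
      rw [mul_assoc]
      exact abs_rpow_sub_two_mul_le (hp i) a b a b (le_max_left _ _) (le_max_right _ _))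
  refine ⟨h1.1, fun i => (h2 i).1, ?_⟩
  refine tendsto_nhds_unique (tendsto_finsetSum Finset.univ fun i _ => (h2 i).2) ?_
  refine h1.2.congr fun n => ?_
  exact (heq _ (contDiff_test _ hu hu1 hΨ) (hasCompactSupport_test _ hΨc)).symm

/-- The stability inequality tested with `u ^ (-κ) * Ψ`. -/
theorem stability_test {p : Fin N → ℝ} (hp : ∀ i, 2 < p i) {κ : ℝ} (hκ : 0 ≤ κ)
    {u H : 𝔼 → ℝ} {Du : Fin N → 𝔼 → ℝ} (hDu : IsWeakGradient p u Du)
    (hu : LocallyIntegrable u volume) (hu1 : ∀ᵐ x, 1 ≤ u x) (hH : LocallyIntegrable H volume)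
    (hst : ∀ φ : 𝔼 → ℝ, ContDiff ℝ 1 φ → HasCompactSupport φ →
      ∫ x, H x * φ x ^ 2 ≤ ∑ i, (p i - 1) * ∫ x, |Du i x| ^ (p i - 2) * |partialDeriv i φ x| ^ 2)
    {Ψ : 𝔼 → ℝ} (hΨ : ContDiff ℝ 1 Ψ) (hΨc : HasCompactSupport Ψ) :
    Integrable (fun x => H x * (u x ^ (-κ) * Ψ x) ^ 2) ∧
    (∀ i, Integrable fun x => |Du i x| ^ (p i - 2) *
      |-κ * u x ^ (-κ - 1) * Du i x * Ψ x + u x ^ (-κ) * partialDeriv i Ψ x| ^ 2) ∧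
    ∫ x, H x * (u x ^ (-κ) * Ψ x) ^ 2 ≤ ∑ i, (p i - 1) * ∫ x, |Du i x| ^ (p i - 2) *
      |-κ * u x ^ (-κ - 1) * Du i x * Ψ x + u x ^ (-κ) * partialDeriv i Ψ x| ^ 2 := by
  have h1 := tendsto_integral_mul_test hκ hu hu1 hH hΨ.continuous hΨc two_ne_zero
  have h2 := fun i => tendsto_integral_comp_partialDeriv (hp i) hκ (hDu i).1 (hDu i).2 hu1 hΨ hΨc
    (F := fun a b => |a| ^ (p i - 2) * |b| ^ 2)
    (by
      have h : Continuous fun a : ℝ × ℝ => |a.1| ^ (p i - 2) :=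
        continuous_fst.abs.rpow_const fun _ => Or.inr (by linarith [hp i])
      exact h.mul (continuous_snd.abs.pow 2)) (fun a => by simp) (fun a b => by
      rw [pow_two]
      exact abs_rpow_sub_two_mul_le (hp i) a b |b| |b| (by simp) (by simp))
  refine ⟨h1.1, fun i => (h2 i).1, ?_⟩
  refine le_of_tendsto_of_tendsto' h1.2
    (tendsto_finsetSum Finset.univ fun i _ => ((h2 i).2.const_mul (p i - 1))) fun n => ?_
  exact hst _ (contDiff_test _ hu hu1 hΨ) (hasCompactSupport_test _ hΨc)

/-! ### Pointwise absorption and Young's inequality -/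

/-- Absorption of the terms that contain `v` into the negative definite part of the form. -/
theorem exists_quadratic_absorption {p α β m μ : ℝ} (hp : 2 < p)
    (h : (p - 1) * α ^ 2 < μ * β) :
    ∃ C : ℝ, 0 ≤ C ∧ ∀ v z : ℝ, |v| ^ (p - 2) *
      ((p - 1) * (-α * v + m * z) ^ 2 + μ * (v * (-β * v + 2 * m * z))) ≤ C * |z| ^ p := by
  set κ := μ * β - (p - 1) * α ^ 2 with hκ
  have hκ0 : 0 < κ := by linarith
  set b := 2 * m * μ - 2 * (p - 1) * α * m with hb
  set C₁ := b ^ 2 / (2 * κ) + (p - 1) * m ^ 2 with hC₁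
  have hC₁0 : 0 ≤ C₁ := by
    have : 0 ≤ p - 1 := by linarith
    positivity
  -- The form equals `-κ * v ^ 2 + b * v * z + (p - 1) * m ^ 2 * z ^ 2`; half of the negative square
  -- absorbs the cross term.
  have hQ : ∀ v z : ℝ, (p - 1) * (-α * v + m * z) ^ 2 + μ * (v * (-β * v + 2 * m * z))
      ≤ C₁ * z ^ 2 - κ / 2 * v ^ 2 := by
    intro v z
    have h1 : C₁ * z ^ 2 - κ / 2 * v ^ 2
        - ((p - 1) * (-α * v + m * z) ^ 2 + μ * (v * (-β * v + 2 * m * z)))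
        = (κ * v - b * z) ^ 2 / (2 * κ) := by
      rw [hC₁]
      field_simp
      rw [hb, hκ]
      ring
    have h2 : 0 ≤ (κ * v - b * z) ^ 2 / (2 * κ) := by positivity
    linarith
  -- Beyond `|v| = K * |z|` the form is nonpositive; below it, `|v| ^ (p - 2)` is controlled by `z`.
  set K := Real.sqrt (2 * C₁ / κ) with hK
  refine ⟨K ^ (p - 2) * C₁, by positivity, fun v z => ?_⟩
  have hv0 := Real.rpow_nonneg (abs_nonneg v) (p - 2)
  by_cases hvz : |v| ≤ K * |z|
  · have h1 := Real.rpow_le_rpow (abs_nonneg v) hvz (show 0 ≤ p - 2 by linarith)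
    have h2 : (p - 1) * (-α * v + m * z) ^ 2 + μ * (v * (-β * v + 2 * m * z)) ≤ C₁ * z ^ 2 := by
      have : 0 ≤ κ / 2 * v ^ 2 := by positivity
      linarith [hQ v z]
    calc _ ≤ |v| ^ (p - 2) * (C₁ * z ^ 2) := by gcongr
      _ ≤ (K * |z|) ^ (p - 2) * (C₁ * z ^ 2) := by gcongr
      _ = K ^ (p - 2) * C₁ * (|z| ^ (p - 2) * |z| ^ (2 : ℕ)) := by
          rw [Real.mul_rpow (Real.sqrt_nonneg _) (abs_nonneg z), sq_abs]; ring
      _ = K ^ (p - 2) * C₁ * |z| ^ p := by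
          rw [← Real.rpow_natCast, ← Real.rpow_add_of_nonneg (abs_nonneg z) (by linarith) (by simp)]
          norm_num
  · push Not at hvz
    have h1 : (K * |z|) ^ 2 ≤ |v| ^ 2 := by gcongr
    rw [mul_pow, hK, Real.sq_sqrt (by positivity), sq_abs, sq_abs, div_mul_eq_mul_div,
      div_le_iff₀ hκ0] at h1
    have h2 : (p - 1) * (-α * v + m * z) ^ 2 + μ * (v * (-β * v + 2 * m * z)) ≤ 0 := by
      linarith [hQ v z]
    exact (mul_nonpos_of_nonneg_of_nonpos hv0 h2).trans (by positivity)

theorem exists_young {θ ε C₀ : ℝ} (h0 : 0 < θ) (h1 : θ < 1) (hε : 0 < ε) (hC₀ : 0 ≤ C₀) :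
    ∃ C : ℝ, 0 ≤ C ∧ ∀ X W : ℝ, 0 ≤ X → 0 ≤ W →
      C₀ * (X ^ θ * W ^ (1 - θ)) ≤ ε * X + C * W := by
  -- The `+ 1` covers `C₀ = 0`; `k` is then fixed by `e ^ θ * k ^ (1 - θ) = 1`.
  set e := ε / (C₀ + 1) with he
  have he0 : 0 < e := by positivity
  set k := e ^ (-θ / (1 - θ)) with hk
  have hk0 : 0 < k := by positivity
  refine ⟨C₀ * k, by positivity, fun X W hX hW => ?_⟩
  have h2 := Real.geom_mean_le_arith_mean2_weighted h0.le (show 0 ≤ 1 - θ by linarith)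
    (show 0 ≤ e * X by positivity) (show 0 ≤ k * W by positivity) (by ring)
  have h3 : e ^ θ * k ^ (1 - θ) = 1 := by
    rw [hk, ← Real.rpow_mul he0.le, ← Real.rpow_add he0, div_mul_cancel₀ _ (by linarith)]
    simp
  rw [Real.mul_rpow he0.le hX, Real.mul_rpow hk0.le hW] at h2
  have h4 : X ^ θ * W ^ (1 - θ) ≤ e * X + k * W := by
    calc _ = (e ^ θ * k ^ (1 - θ)) * (X ^ θ * W ^ (1 - θ)) := by rw [h3, one_mul]
      _ ≤ θ * (e * X) + (1 - θ) * (k * W) := by linarith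
      _ ≤ 1 * (e * X) + 1 * (k * W) := by gcongr; linarith
      _ = _ := by ring
  have h5 : C₀ * e ≤ ε := by
    rw [he, mul_div_assoc', div_le_iff₀ (by positivity)]; nlinarith
  calc _ ≤ C₀ * (e * X + k * W) := by gcongr
    _ = (C₀ * e) * X + C₀ * k * W := by ring
    _ ≤ _ := by gcongr

/-- The pointwise bound behind the energy estimate: stability minus a multiple of the equation. -/
theorem exists_pointwise_bound {p α β δ μ ε r : ℝ} {m : ℕ} (hp : 2 < p) (hβ : β = 2 * α + 1)
    (hδ : 0 < δ) (hpβ : p < β + 1) (hμ : (p - 1) * α ^ 2 < μ * β) (hε : 0 < ε)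
    (hr : r = p * (β + δ) / (δ + p - 1)) (hm : r ≤ m) :
    ∃ C : ℝ, 0 ≤ C ∧ ∀ u η v d : ℝ, 1 ≤ u → 0 ≤ η → η ≤ 1 →
      (p - 1) * (|v| ^ (p - 2) *
          |-α * u ^ (-α - 1) * v * η ^ m + u ^ (-α) * (m * η ^ (m - 1) * d)| ^ 2)
        + μ * (|v| ^ (p - 2) * v *
          (-β * u ^ (-β - 1) * v * η ^ (2 * m) + u ^ (-β) * ((2 * m) * η ^ (2 * m - 1) * d)))
      ≤ ε * (u ^ (-(δ + β)) * η ^ (2 * m)) + C * |d| ^ r := by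
  have hβδ : 0 < β + δ := by linarith
  have hδp : 0 < δ + p - 1 := by linarith
  have hr2 : 2 < r := by
    rw [hr, lt_div_iff₀ hδp]; nlinarith
  have hm2 : 2 < m := by exact_mod_cast hr2.trans_le hm
  obtain ⟨C₀, hC₀, hA⟩ := exists_quadratic_absorption (m := m) hp hμ
  -- This exponent matches the powers of `u`: `-(δ + β) * θ = p - β - 1`. Then `r` is forced by `r *
  -- (1 - θ) = p`.
  set θ := (β + 1 - p) / (β + δ) with hθ
  have hθ0 : 0 < θ := div_pos (by linarith) hβδ
  have hθ1 : θ < 1 := by rw [hθ, div_lt_one hβδ]; linarith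
  have hrθ : r * (1 - θ) = p := by
    rw [hr, hθ]; field_simp; ring
  have huθ : -(δ + β) * θ = -β - 1 + p := by
    rw [hθ]; field_simp; ring
  obtain ⟨C, hC, hY⟩ := exists_young hθ0 hθ1 hε hC₀
  refine ⟨C, hC, fun u η v d hu hη0 hη1 => ?_⟩
  have hu0 : 0 < u := by linarith
  -- Below, `z` divides by `η`. At `η = 0` every power of `η` has a positive exponent because `m >
  -- 2`, so the left side vanishes.
  rcases hη0.eq_or_lt with h | hη
  · have h1 : m - 1 ≠ 0 := by omega
    have h2 : 2 * m - 1 ≠ 0 := by omega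
    have h3 : m ≠ 0 := by omega
    simp only [← h, zero_pow h1, zero_pow h2, zero_pow h3, zero_pow (mul_ne_zero two_ne_zero h3)]
    simp
    positivity
  set z := u * d / η with hz
  have e1 : -α * u ^ (-α - 1) * v * η ^ m + u ^ (-α) * (m * η ^ (m - 1) * d)
      = u ^ (-α - 1) * η ^ m * (-α * v + m * z) := by
    rw [show η ^ m = η ^ (m - 1) * η by rw [← pow_succ]; congr 1; omega, hz,
      Real.rpow_sub_one hu0.ne']
    field_simp
  have e2 : -β * u ^ (-β - 1) * v * η ^ (2 * m) + u ^ (-β) * ((2 * m) * η ^ (2 * m - 1) * d)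
      = u ^ (-β - 1) * η ^ (2 * m) * (-β * v + 2 * m * z) := by
    rw [show η ^ (2 * m) = η ^ (2 * m - 1) * η by rw [← pow_succ]; congr 1; omega, hz,
      Real.rpow_sub_one hu0.ne']
    field_simp
  have e3 : (u ^ (-α - 1)) ^ 2 = u ^ (-β - 1) := by
    rw [← Real.rpow_natCast, ← Real.rpow_mul hu0.le, hβ]; congr 1; push_cast; ring
  set P := u ^ (-β - 1) * η ^ (2 * m) with hP
  have hP0 : 0 < P := by positivity
  have e4 : P * |z| ^ p = (u ^ (-(δ + β)) * η ^ (2 * m)) ^ θ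
      * (η ^ (2 * m) * (|d| / η) ^ r) ^ (1 - θ) := by
    have hη2 : 0 < η ^ (2 * m) := by positivity
    rw [Real.mul_rpow (by positivity) hη2.le, Real.mul_rpow hη2.le (by positivity),
      ← Real.rpow_mul hu0.le, ← Real.rpow_mul (by positivity), hrθ, huθ, Real.rpow_add hu0, hz,
      abs_div, abs_mul, abs_of_pos hu0, abs_of_pos hη, mul_div_assoc,
      Real.mul_rpow hu0.le (by positivity), hP]
    have : (η ^ (2 * m)) ^ θ * (η ^ (2 * m)) ^ (1 - θ) = η ^ (2 * m) := by
      rw [← Real.rpow_add hη2]; simp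
    linear_combination (-(u ^ (-β - 1) * u ^ p * (|d| / η) ^ p)) * this
  -- Here `m ≥ r` is used: `η ^ (2 * m) ≤ η ^ r` for `η ≤ 1`.
  have e5 : η ^ (2 * m) * (|d| / η) ^ r ≤ |d| ^ r := by
    rw [Real.div_rpow (abs_nonneg d) hη0, mul_div_assoc', div_le_iff₀ (by positivity), mul_comm]
    refine mul_le_mul_of_nonneg_left ?_ (by positivity)
    rw [← Real.rpow_natCast]
    refine Real.rpow_le_rpow_of_exponent_ge hη hη1 ?_
    push_cast; linarith
  rw [e1, e2, sq_abs, mul_pow, mul_pow, e3, ← pow_mul, mul_comm m 2, ← hP]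
  calc _ = P * (|v| ^ (p - 2) *
        ((p - 1) * (-α * v + m * z) ^ 2 + μ * (v * (-β * v + 2 * m * z)))) := by ring
    _ ≤ P * (C₀ * |z| ^ p) := mul_le_mul_of_nonneg_left (hA v z) hP0.le
    _ = C₀ * (P * |z| ^ p) := by ring
    _ ≤ ε * (u ^ (-(δ + β)) * η ^ (2 * m)) + C * (η ^ (2 * m) * (|d| / η) ^ r) := by
        rw [e4]; exact hY _ _ (by positivity) (by positivity)
    _ ≤ _ := by gcongr

/-! ### The energy estimate -/

theorem partialDeriv_pow {η : 𝔼 → ℝ} {x : 𝔼} (hη : DifferentiableAt ℝ η x) (k : ℕ) (i : Fin N) :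
    partialDeriv i (fun y => η y ^ k) x = k * η x ^ (k - 1) * partialDeriv i η x := by
  have h := hη.hasFDerivAt.pow k
  rw [partialDeriv, h.fderiv]
  simp [partialDeriv]

theorem deriv_singularF {δ γ t : ℝ} (ht : 0 < t) :
    deriv (singularF δ γ) t = δ * t ^ (-δ - 1) + γ * t ^ (-γ - 1) := by
  have h := ((Real.hasDerivAt_rpow_const (p := -δ) (Or.inl ht.ne')).add
    (Real.hasDerivAt_rpow_const (p := -γ) (Or.inl ht.ne'))).neg
  change deriv (-((fun t : ℝ => t ^ (-δ)) + fun t : ℝ => t ^ (-γ))) t = _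
  rw [h.deriv]
  ring

theorem locallyIntegrable_mul_of_bounded {g w : 𝔼 → ℝ} {C : ℝ} (hg : LocallyIntegrable g volume)
    (hw : AEStronglyMeasurable w volume) (hC : ∀ᵐ x, |w x| ≤ C) :
    LocallyIntegrable (fun x => g x * w x) volume := by
  rw [locallyIntegrable_iff] at hg ⊢
  intro K hK
  exact (hg K hK).mul_bdd hw.restrict (ae_restrict_of_ae hC)

/-- The energy estimate for a solution that is stable. -/
theorem exists_energy_estimate {p : Fin N → ℝ} (hp : ∀ i, 2 < p i) {g u : 𝔼 → ℝ}
    (hg : LocallyIntegrable g volume) {c : ℝ} (hc : 0 < c) (hgc : ∀ᵐ x, c ≤ g x)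
    {δ γ α β μ : ℝ} (hδ : 0 < δ) (hδγ : δ < γ) (hα : 0 ≤ α) (hβ : β = 2 * α + 1)
    (hpβ : ∀ i, p i < β + 1) (hμ : ∀ i, (p i - 1) * α ^ 2 < μ * β) (hμδ : μ < δ)
    (hu1 : ∀ᵐ x, 1 ≤ u x) (hst : IsStableSolution p g (singularF δ γ) u)
    {m : ℕ} (hm0 : m ≠ 0) (hm : ∀ i, p i * (β + δ) / (δ + p i - 1) ≤ m) :
    ∃ C : Fin N → ℝ, ∀ η : 𝔼 → ℝ, ContDiff ℝ 1 η → HasCompactSupport η →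
      (∀ x, 0 ≤ η x) → (∀ x, η x ≤ 1) →
      Integrable (fun x => u x ^ (-(δ + β)) * η x ^ (2 * m)) ∧
      ∫ x, u x ^ (-(δ + β)) * η x ^ (2 * m)
        ≤ ∑ i, C i * ∫ x, |partialDeriv i η x| ^ (p i * (β + δ) / (δ + p i - 1)) := by
  obtain ⟨⟨hu, -⟩, -, hf, hf', Du, hDu, htest⟩ := hst
  have hγ : 0 < γ := hδ.trans hδγ
  have hβ0 : 0 < β := by linarith
  have hβ1 : 1 ≤ β := by linarith
  have hH1 : LocallyIntegrable (fun x => g x * singularF δ γ (u x)) volume := by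
    refine locallyIntegrable_mul_of_bounded (C := 2) hg hf.aestronglyMeasurable ?_
    filter_upwards [hu1] with x hx
    have h1 := rpow_neg_le_one hx hδ.le
    have h2 := rpow_neg_le_one hx hγ.le
    have h0 : 0 < u x := by linarith
    rw [singularF, abs_neg, abs_of_pos (by positivity)]
    linarith
  have hH2 : LocallyIntegrable (fun x => g x * deriv (singularF δ γ) (u x)) volume := by
    refine locallyIntegrable_mul_of_bounded (C := δ * 1 + γ * 1) hg hf'.aestronglyMeasurable ?_
    filter_upwards [hu1] with x hx
    have h1 := rpow_neg_le_one hx (show 0 ≤ δ + 1 by linarith)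
    have h2 := rpow_neg_le_one hx (show 0 ≤ γ + 1 by linarith)
    have h0 : 0 < u x := by linarith
    rw [deriv_singularF h0, abs_of_pos (by positivity), show -δ - 1 = -(δ + 1) by ring,
      show -γ - 1 = -(γ + 1) by ring]
    gcongr
  -- The `N` Young terms together cost at most half of `(δ - μ) * c`; `N + 1` keeps the denominator
  -- positive for `N = 0`.
  set ε := (δ - μ) * c / (2 * (N + 1)) with hε
  have hδμ : 0 < δ - μ := by linarith
  have hε0 : 0 < ε := by positivity
  have hNε : N * ε ≤ (δ - μ) * c / 2 := by
    rw [hε, mul_div_assoc', div_le_div_iff₀ (by positivity) (by norm_num)]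
    have : 0 < (δ - μ) * c := by positivity
    nlinarith
  choose C hC0 hC using fun i => exists_pointwise_bound (hp i) hβ hδ (hpβ i) (hμ i) hε0 rfl (hm i)
  refine ⟨fun i => C i / ((δ - μ) * c / 2), fun η hη hηc hη0 hη1 => ?_⟩
  have hr0 : ∀ i, 0 < p i * (β + δ) / (δ + p i - 1) := fun i =>
    div_pos (mul_pos (by linarith [hp i]) (by linarith)) (by linarith [hp i])
  have hpow : ∀ k : ℕ, k ≠ 0 → ContDiff ℝ 1 (fun x => η x ^ k) ∧
      HasCompactSupport fun x => η x ^ k := fun k hk =>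
    ⟨hη.pow k, hηc.mono fun x hx h0 => hx (by simp [h0, hk])⟩
  have h2m : 2 * m ≠ 0 := by omega
  obtain ⟨hE1, hE2, hE3⟩ := weak_equation_test hp hβ0.le hDu hu hu1 hH1
    (fun φ h1 h2 => (htest φ h1 h2).1) (hpow _ h2m).1 (hpow _ h2m).2
  obtain ⟨hS1, hS2, hS3⟩ := stability_test hp hα hDu hu hu1 hH2
    (fun φ h1 h2 => (htest φ h1 h2).2) (hpow _ hm0).1 (hpow _ hm0).2
  have hdiff : ∀ x, DifferentiableAt ℝ η x := fun x => hη.differentiable (by norm_num) x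
  simp only [partialDeriv_pow (hdiff _), Nat.cast_mul, Nat.cast_ofNat] at hE1 hE2 hE3 hS1 hS2 hS3
  have hX : Integrable fun x => u x ^ (-(δ + β)) * η x ^ (2 * m) := by
    have := (tendsto_integral_mul_test (κ := δ + β) (by linarith) hu hu1
      (H := fun _ => 1) continuous_const.locallyIntegrable (hpow _ h2m).1.continuous
      (hpow _ h2m).2 one_ne_zero).1
    simpa using this
  refine ⟨hX, ?_⟩
  have hd : ∀ i, Integrable fun x => |partialDeriv i η x| ^ (p i * (β + δ) / (δ + p i - 1)) := by
    intro i
    refine Continuous.integrable_of_hasCompactSupport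
      ((continuous_partialDeriv hη i).abs.rpow_const fun x => Or.inr (hr0 i).le) ?_
    refine (hasCompactSupport_partialDeriv hηc i).mono fun x hx h0 => hx ?_
    simp [h0, Real.zero_rpow (hr0 i).ne']
  -- the left hand sides
  have hlow : (δ - μ) * c * ∫ x, u x ^ (-(δ + β)) * η x ^ (2 * m)
      ≤ (∫ x, g x * deriv (singularF δ γ) (u x) * (u x ^ (-α) * η x ^ m) ^ 2)
        + μ * ∫ x, g x * singularF δ γ (u x) * (u x ^ (-β) * η x ^ (2 * m)) := by
    rw [← integral_const_mul, ← integral_const_mul, ← integral_add hS1 (hE1.const_mul μ)]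
    refine integral_mono_ae (hX.const_mul _) (hS1.add (hE1.const_mul μ)) ?_
    filter_upwards [hu1, hgc] with x hx hgx
    have h0 : 0 < u x := by linarith
    have hη' : 0 ≤ η x ^ (2 * m) := pow_nonneg (hη0 x) _
    have e1 : (u x ^ (-α) * η x ^ m) ^ 2 = u x ^ (-β) * u x * η x ^ (2 * m) := by
      rw [mul_pow, ← pow_mul, mul_comm m 2, ← Real.rpow_natCast, ← Real.rpow_mul h0.le,
        ← Real.rpow_add_one h0.ne', hβ]
      congr 2; push_cast; ring
    have e2 : u x ^ (-(δ + β)) = u x ^ (-δ) * u x ^ (-β) := by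
      rw [← Real.rpow_add h0]; congr 1; ring
    rw [e1, e2, deriv_singularF h0, singularF, Real.rpow_sub_one h0.ne', Real.rpow_sub_one h0.ne']
    have ha := Real.rpow_pos_of_pos h0 (-δ)
    have hb := Real.rpow_pos_of_pos h0 (-γ)
    have hW : 0 ≤ u x ^ (-β) * η x ^ (2 * m) := mul_nonneg (Real.rpow_pos_of_pos h0 _).le hη'
    -- The extra `u x` from `2 * α = β - 1` cancels the one lost in differentiating `f`. Both
    -- coefficients `δ - μ` and `γ - μ` are positive, and the `γ` term is dropped.
    have e3 : g x * (δ * (u x ^ (-δ) / u x) + γ * (u x ^ (-γ) / u x)) *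
          (u x ^ (-β) * u x * η x ^ (2 * m))
        + μ * (g x * -(u x ^ (-δ) + u x ^ (-γ)) * (u x ^ (-β) * η x ^ (2 * m)))
        = g x * ((δ - μ) * u x ^ (-δ) + (γ - μ) * u x ^ (-γ))
          * (u x ^ (-β) * η x ^ (2 * m)) := by
      field_simp
      ring
    rw [e3, ← mul_assoc _ (u x ^ (-δ) * _), mul_comm (u x ^ (-δ)), ← mul_assoc]
    have h1 : c * ((δ - μ) * u x ^ (-δ)) ≤ g x * ((δ - μ) * u x ^ (-δ) + (γ - μ) * u x ^ (-γ)) := by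
      have : 0 ≤ (γ - μ) * u x ^ (-γ) := mul_nonneg (by linarith) hb.le
      have : 0 ≤ (δ - μ) * u x ^ (-δ) := mul_nonneg hδμ.le ha.le
      exact mul_le_mul hgx (by linarith) this (by linarith)
    linarith [mul_le_mul_of_nonneg_right h1 hW]
  have hup : (∫ x, g x * deriv (singularF δ γ) (u x) * (u x ^ (-α) * η x ^ m) ^ 2)
        + μ * ∫ x, g x * singularF δ γ (u x) * (u x ^ (-β) * η x ^ (2 * m))
      ≤ ∑ i, (ε * (∫ x, u x ^ (-(δ + β)) * η x ^ (2 * m))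
        + C i * ∫ x, |partialDeriv i η x| ^ (p i * (β + δ) / (δ + p i - 1))) := by
    rw [← hE3]
    refine (add_le_add_left hS3 _).trans ?_
    rw [Finset.mul_sum, ← Finset.sum_add_distrib]
    refine Finset.sum_le_sum fun i _ => ?_
    rw [← integral_const_mul, ← integral_const_mul, ← integral_const_mul, ← integral_const_mul,
      ← integral_add ((hS2 i).const_mul _) ((hE2 i).const_mul _),
      ← integral_add (hX.const_mul _) ((hd i).const_mul _)]
    refine integral_mono_ae (((hS2 i).const_mul _).add ((hE2 i).const_mul _))
      ((hX.const_mul _).add ((hd i).const_mul _)) ?_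
    filter_upwards [hu1] with x hx
    exact hC i (u x) (η x) (Du i x) (partialDeriv i η x) hx (hη0 x) (hη1 x)
  rw [Finset.sum_add_distrib, Finset.sum_const, Finset.card_univ, Fintype.card_fin,
    nsmul_eq_mul] at hup
  have hXpos : 0 ≤ ∫ x, u x ^ (-(δ + β)) * η x ^ (2 * m) := by
    refine integral_nonneg_of_ae ?_
    filter_upwards [hu1] with x hx
    have h0 : 0 < u x := by linarith
    exact mul_nonneg (Real.rpow_pos_of_pos h0 _).le (pow_nonneg (hη0 x) _)
  simp only [div_mul_eq_mul_div]
  rw [← Finset.sum_div, le_div_iff₀ (by positivity)]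
  nlinarith [mul_le_mul_of_nonneg_right hNε hXpos]

/-! ### Scaling and arithmetic of the exponents -/

theorem integral_partialDeriv_dilation {η : 𝔼 → ℝ} (hη : Differentiable ℝ η) {R : ℝ} (hR : 0 < R)
    (i : Fin N) (r : ℝ) :
    ∫ x, |partialDeriv i (fun y => η (R⁻¹ • y)) x| ^ r
      = R ^ ((N : ℝ) - r) * ∫ x, |partialDeriv i η x| ^ r := by
  have h1 : ∀ x, |partialDeriv i (fun y => η (R⁻¹ • y)) x| ^ r
      = R ^ (-r) * |partialDeriv i η (R⁻¹ • x)| ^ r := by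
    intro x
    have h := (hη (R⁻¹ • x)).hasFDerivAt.comp x ((hasFDerivAt_id x).const_smul R⁻¹)
    have h2 : partialDeriv i (fun y => η (R⁻¹ • y)) x = R⁻¹ * partialDeriv i η (R⁻¹ • x) := by
      change fderiv ℝ (η ∘ HSMul.hSMul R⁻¹) x _ = _
      rw [h.fderiv]
      simp [partialDeriv]
    rw [h2, abs_mul, abs_of_pos (inv_pos.2 hR), Real.mul_rpow (inv_pos.2 hR).le (abs_nonneg _),
      Real.inv_rpow hR.le, Real.rpow_neg hR.le]
  simp only [h1]
  rw [integral_const_mul,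
    Measure.integral_comp_inv_smul_of_nonneg volume (fun x => |partialDeriv i η x| ^ r) hR.le,
    finrank_euclideanSpace, Fintype.card_fin, smul_eq_mul, ← mul_assoc, ← Real.rpow_natCast,
    ← Real.rpow_add hR]
  congr 2
  ring

/-- Each of the other `N - 1` summands exceeds `1`. The sum is `N * (q - 1)`, so this compares the
threshold in `setA` with both `p_N` and the dimension. -/
theorem lastExp_sub_one_add_le_sum (hN : 1 ≤ N) {p : Fin N → ℝ} (hp : ∀ i, 2 < p i) :
    (lastExp hN p - 1) + (N - 1) ≤ ∑ i, (p i - 1) := by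
  have h := Finset.add_sum_erase Finset.univ (fun i => p i - 1)
    (Finset.mem_univ (⟨N - 1, by omega⟩ : Fin N))
  rw [← h]
  refine add_le_add le_rfl ?_
  have h1 := Finset.card_nsmul_le_sum (Finset.univ.erase (⟨N - 1, by omega⟩ : Fin N))
    (fun i => p i - 1) 1 (fun i _ => by linarith [hp i])
  rw [Finset.card_erase_of_mem (Finset.mem_univ _), Finset.card_univ, Fintype.card_fin,
    nsmul_eq_mul, mul_one, Nat.cast_sub hN] at h1
  simpa using h1

theorem mul_meanExp_sub_one (hN : 1 ≤ N) (p : Fin N → ℝ) :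
    N * (meanExp p - 1) = ∑ i, (p i - 1) := by
  have : (N : ℝ) ≠ 0 := by positivity
  rw [meanExp, Finset.sum_sub_distrib]
  simp
  field_simp

theorem le_lastExp (hN : 1 ≤ N) {p : Fin N → ℝ} (hmono : Monotone p) (i : Fin N) :
    p i ≤ lastExp hN p :=
  hmono (Fin.le_def.2 (by have := i.2; simp only; omega))

/-- The volume growth exponent beats the dimension. -/
theorem dim_lt_decayExp {P M n pi δ s : ℝ} (hs : s = 4 * δ / (P - 1)) (hP : 2 < P) (hpi : 2 < pi)
    (hn : 1 ≤ n) (hM : (P - 1) + (n - 1) ≤ M) (hMs : M < s) (hδ : 0 < δ)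
    (hden : 0 < pi * (M + 4) - n * M) :
    n < pi * ((1 + s) + δ) / (δ + pi - 1) := by
  have hM0 : 0 < M := by linarith
  have hsP : 4 * δ = s * (P - 1) := by rw [hs]; field_simp [show P - 1 ≠ 0 by linarith]
  rw [lt_div_iff₀ (by linarith)]
  have h1 : 0 < δ * (pi * (M + 4) - n * M) := mul_pos hδ hden
  -- After multiplication by `M` and use of `h1`, what remains is `pi * M * (n - 1) - n * M ≤ pi * s
  -- * (M - (P - 1))`, which follows from this product of `M < s` and `n - 1 ≤ M - (P - 1)`.
  have h2 : M * (n - 1) ≤ s * (M - (P - 1)) :=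
    mul_le_mul hMs.le (by linarith) (by linarith) (by linarith)
  have h3 : pi * (M * (n - 1)) ≤ pi * (s * (M - (P - 1))) :=
    mul_le_mul_of_nonneg_left h2 (by linarith)
  have h4 : 0 < n * M := by positivity
  refine lt_of_mul_lt_mul_left ?_ hM0.le
  have h5 : pi * (4 * δ) = pi * (s * (P - 1)) := by rw [hsP]
  nlinarith

end AnisotropicStable

end

open AnisotropicStable Filter Topology

/-! ### Choice of parameters and the limit of large radius -/

theorem theorem3p3 (N : ℕ) (hN : 1 ≤ N) (p : Fin N → ℝ) (hp : ∀ i, 2 < p i) (hmono : Monotone p)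
    (g : EuclideanSpace ℝ (Fin N) → ℝ) (hg : LocallyIntegrable g volume)
    (hgpos : ∃ c : ℝ, 0 < c ∧ ∀ᵐ x, c ≤ g x)
    (hden : ∀ i, 0 < AnisotropicStable.denomI p i)
    (δ γ : ℝ) (hδ : 0 < δ) (hδγ : δ < γ)
    (hδA : δ ∈ AnisotropicStable.setA hN p)
    (hγI : γ ∈ AnisotropicStable.setI p ∩ Ici (1 : ℝ))
    (u : EuclideanSpace ℝ (Fin N) → ℝ) (hu : AnisotropicStable.MemW1pLoc p u)
    (hu1 : ∀ᵐ x, 1 ≤ u x) :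
    ¬ AnisotropicStable.IsStableSolution p g (AnisotropicStable.singularF δ γ) u := by
  intro hst
  obtain ⟨c, hc, hgc⟩ := hgpos
  set P := lastExp hN p with hPdef
  set M := ∑ i, (p i - 1) with hMdef
  have hP : 2 < P := hp _
  have hN1 : (1 : ℝ) ≤ N := by exact_mod_cast hN
  have hM : (P - 1) + (N - 1) ≤ M := lastExp_sub_one_add_le_sum hN hp
  -- With `s = 2 * α` this is the value for which `(P - 1) * α ^ 2 = δ * s`; membership of `δ` in
  -- `setA` says exactly `M < s`.
  set s := 4 * δ / (P - 1) with hs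
  have hMs : M < s := by
    have h := hδA
    rw [setA, mem_Ioi, mul_meanExp_sub_one hN, ← hMdef, ← hPdef] at h
    rw [hs, lt_div_iff₀ (by linarith)]
    linarith
  have hs0 : 0 < s := by linarith
  have hsP : s * (P - 1) = 4 * δ := by
    rw [hs]; field_simp [show P - 1 ≠ 0 by linarith]
  have hr : ∀ i, (N : ℝ) < p i * ((1 + s) + δ) / (δ + p i - 1) := by
    intro i
    refine dim_lt_decayExp hs hP (hp i) hN1 hM hMs hδ ?_
    have h := hden i
    rw [denomI, mul_meanExp_sub_one hN, pow_two, mul_assoc, mul_meanExp_sub_one hN] at h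
    exact h
  obtain ⟨m, hm⟩ := exists_nat_ge (1 + ∑ i, p i * ((1 + s) + δ) / (δ + p i - 1))
  have hr0 : ∀ i, 0 ≤ p i * ((1 + s) + δ) / (δ + p i - 1) := fun i => by linarith [hr i]
  have hm0 : m ≠ 0 := by
    rintro rfl
    have := Finset.sum_nonneg fun i (_ : i ∈ Finset.univ) => hr0 i
    push_cast at hm
    linarith
  have hmr : ∀ i, p i * ((1 + s) + δ) / (δ + p i - 1) ≤ m := fun i => by
    linarith [Finset.single_le_sum (fun j _ => hr0 j) (Finset.mem_univ i)]
  -- The requirement on `μ` is `δ * s / (1 + s) < μ < δ`; the midpoint of this interval is taken.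
  obtain ⟨C, hC⟩ := exists_energy_estimate (α := s / 2) (β := 1 + s)
    (μ := δ * (2 * s + 1) / (2 * s + 2)) hp hg hc hgc hδ hδγ (by positivity) (by ring)
    (fun i => by linarith [le_lastExp hN hmono i]) (fun i => by
      have h1 : δ * (2 * s + 1) / (2 * s + 2) * (1 + s) = δ * s + δ / 2 := by
        field_simp; ring
      have h2 : (p i - 1) * (s / 2) ^ 2 ≤ (P - 1) * (s / 2) ^ 2 := by
        gcongr
        exact le_lastExp hN hmono i
      have h3 : (P - 1) * (s / 2) ^ 2 = s * (s * (P - 1)) / 4 := by ring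
      rw [hsP] at h3
      linarith)
    (by rw [div_lt_iff₀ (by positivity)]; nlinarith) hu1 hst hm0 hmr
  let η₁ : ContDiffBump (0 : EuclideanSpace ℝ (Fin N)) := ⟨1, 2, one_pos, one_lt_two⟩
  have hη₁ : ContDiff ℝ 1 η₁ := η₁.contDiff
  have hη : ∀ R : ℝ, 0 < R → ContDiff ℝ 1 (fun x => η₁ (R⁻¹ • x)) ∧
      HasCompactSupport (fun x => η₁ (R⁻¹ • x)) := fun R hR =>
    ⟨hη₁.comp (contDiff_id.const_smul R⁻¹),
      η₁.hasCompactSupport.comp_homeomorph (Homeomorph.smulOfNeZero R⁻¹ (inv_ne_zero hR.ne'))⟩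
  have hbound : ∀ R : ℝ, 1 ≤ R →
      ∫ x in Metric.closedBall (0 : EuclideanSpace ℝ (Fin N)) 1, u x ^ (-(δ + (1 + s)))
        ≤ ∑ i, C i * (R ^ ((N : ℝ) - p i * ((1 + s) + δ) / (δ + p i - 1)) *
          ∫ x, |partialDeriv i η₁ x| ^ (p i * ((1 + s) + δ) / (δ + p i - 1))) := by
    intro R hR
    have hR0 : 0 < R := by linarith
    obtain ⟨h1, h2⟩ := hC _ (hη R hR0).1 (hη R hR0).2 (fun x => η₁.nonneg) (fun x => η₁.le_one)
    simp only [integral_partialDeriv_dilation (hη₁.differentiable (by norm_num)) hR0] at h2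
    refine le_trans ?_ h2
    have e1 : ∫ x in Metric.closedBall (0 : EuclideanSpace ℝ (Fin N)) 1, u x ^ (-(δ + (1 + s)))
        = ∫ x in Metric.closedBall (0 : EuclideanSpace ℝ (Fin N)) 1,
          u x ^ (-(δ + (1 + s))) * η₁ (R⁻¹ • x) ^ (2 * m) := by
      refine setIntegral_congr_fun measurableSet_closedBall fun x hx => ?_
      have : η₁ (R⁻¹ • x) = 1 := by
        refine η₁.one_of_mem_closedBall ?_
        rw [mem_closedBall_zero_iff] at hx ⊢
        rw [norm_smul, norm_inv, Real.norm_of_nonneg hR0.le, inv_mul_le_iff₀ hR0]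
        change ‖x‖ ≤ R * 1
        linarith
      simp [this]
    rw [e1]
    refine setIntegral_le_integral h1 ?_
    filter_upwards [hu1] with x hx
    exact mul_nonneg (Real.rpow_nonneg (by linarith) _) (pow_nonneg η₁.nonneg _)
  have hlim : Tendsto (fun R : ℝ => ∑ i, C i *
      (R ^ ((N : ℝ) - p i * ((1 + s) + δ) / (δ + p i - 1)) *
        ∫ x, |partialDeriv i η₁ x| ^ (p i * ((1 + s) + δ) / (δ + p i - 1)))) atTop (𝓝 0) := by
    have h0 : ∑ _ : Fin N, (0 : ℝ) = 0 := Finset.sum_const_zero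
    refine h0 ▸ tendsto_finsetSum (a := fun _ => (0 : ℝ)) Finset.univ fun i _ => ?_
    have h := tendsto_rpow_neg_atTop (sub_pos.2 (hr i))
    rw [neg_sub] at h
    simpa using (h.mul_const
      (∫ x, |partialDeriv i η₁ x| ^ (p i * ((1 + s) + δ) / (δ + p i - 1)))).const_mul (C i)
  have hle : ∫ x in Metric.closedBall (0 : EuclideanSpace ℝ (Fin N)) 1,
      u x ^ (-(δ + (1 + s))) ≤ 0 :=
    -- For `R ≥ 1` the dilated cutoff equals `1` on the unit ball, so the left side is independent
    -- of `R`.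
    ge_of_tendsto hlim (eventually_atTop.2 ⟨1, hbound⟩)
  refine hle.not_gt ?_
  have hmeas : AEStronglyMeasurable (fun x => u x ^ (-(δ + (1 + s)))) volume :=
    (hu.1.aestronglyMeasurable.aemeasurable.pow_const _).aestronglyMeasurable
  have hpos : ∀ᵐ x ∂volume.restrict (Metric.closedBall (0 : EuclideanSpace ℝ (Fin N)) 1),
      0 < u x ^ (-(δ + (1 + s))) := by
    refine ae_restrict_of_ae ?_
    filter_upwards [hu1] with x hx
    exact Real.rpow_pos_of_pos (by linarith) _
  have hint : IntegrableOn (fun x => u x ^ (-(δ + (1 + s))))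
      (Metric.closedBall (0 : EuclideanSpace ℝ (Fin N)) 1) := by
    refine Measure.integrableOn_of_bounded (M := 1)
      (isCompact_closedBall _ _).measure_lt_top.ne hmeas ?_
    refine ae_restrict_of_ae ?_
    filter_upwards [hu1] with x hx
    rw [Real.norm_of_nonneg (Real.rpow_nonneg (by linarith) _)]
    exact rpow_neg_le_one hx (by linarith)
  rw [integral_pos_iff_support_of_nonneg_ae (hpos.mono fun x hx => hx.le) hint]
  have hsupp : Function.support (fun x => u x ^ (-(δ + (1 + s))))
      =ᵐ[volume.restrict (Metric.closedBall (0 : EuclideanSpace ℝ (Fin N)) 1)] univ := by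
    filter_upwards [hpos] with x hx
    exact eq_true hx.ne'
  rw [measure_congr hsupp, Measure.restrict_apply_univ]
  exact Metric.measure_closedBall_pos volume _ one_pos
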